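/- Let $M$ be a compact connected $C^\infty$-manifold on which a compact Lie group $G$, $d=\dim G$, acts smoothly, effectively and transitively (so $M=G/K$ for a closed subgroup $K$), and let $dx$ be a finite $G$-invariant Borel measure on $M$. For $1\le p\le\infty$ let $L_p(M)=L_p(M,dx)$ be the Banach space of scalar-valued functions, with scalars $\mathbb{R}$ or $\mathbb{C}$. For $X$ in the Lie algebra of $G$ let $e^{tD_X}f(x)=f(\exp tX\cdot x)$, $t\in\mathbb{R}$, be the associated one-parameter group of isometries of $L_p(M)$, and let $D_X$ be its generator: $f$ is in the domain of $D_X$ and $D_Xf=g$ if and only if $t^{-1}(e^{tD_X}f-f)\to g$ in the norm of $L_p(M)$ as $t\to0$. Let $X_1,\dots,X_d$ be elements of the Lie algebra of $G$ such that, as differential operators on $C^\infty(M)$, where $Xf(x)=\frac{d}{dt}f(\exp tX\cdot x)|_{t=0}$, the operator $X_1^2+\dots+X_d^2$ commutes with each $X_j$. Put $D_j=D_{X_j}$ and $\mathbb{D}=\{D_1,\dots,D_d\}$, and let $\omega>0$. For every $i$ and every $g\in L_p(M)$ the series in $$\mathcal{R}^\omega_i g=\frac{\omega}{\pi^2}\sum_{j\in\mathbb{Z}}\frac{(-1)^{j-1}}{(j-1/2)^2}\,e^{\frac{\pi}{\omega}(j-1/2)D_i}g$$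 converges in $L_p(M)$ (unconditionally), and for every $f\in L_p(M)$ the following conditions are equivalent. (1) $f$ belongs to the Bernstein space $\mathbf{B}^p_\omega(\mathbb{D})$: for all $k\ge0$ and all $1\le i_1,\dots,i_k\le d$, $f$ is in the domain of $D_{i_1}\cdots D_{i_k}$ and $$\|D_{i_1}\cdots D_{i_k}f\|_p\le\omega^k\|f\|_p .$$ (2) For all $k\ge0$ and all $1\le i_1,\dots,i_k\le d$, $f$ is in the domain of $D_{i_1}\cdots D_{i_k}$, and for all $1\le j\le d$ and every functional $\psi^*$ in the dual space $L_p(M)^*$ the function $t\mapsto\langle e^{tD_j}D_{i_1}\cdots D_{i_k}f,\psi^*\rangle$ of the real variable $t$ is bounded on $\mathbb{R}$ and extends to an entire function of exponential type at most $\omega$, i.e. to an entire function $F$ such that for every $\varepsilon>0$ there is a constant $C$ with $|F(z)|\le Ce^{(\omega+\varepsilon)|z|}$ for all $z\in\mathbb{C}$. (3) For all $k\ge0$ and all $1\le i_1,\dots,i_k\le d$, $f$ is in the domain of $D_{i_1}\cdots D_{i_k}$, and the Riesz interpolation formula $$D_{i_1}\cdots D_{i_k}f=\mathcal{R}^\omega_{i_1}\cdots\mathcal{R}^\omega_{i_k}f$$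 holds. (For $k=0$ both products are the identity.) -/

import Mathlib

open MeasureTheory Filter Topology
open scoped Manifold ContDiff ENNReal

noncomputable section

section LieExponential

variable {d : ℕ} {G : Type*} [TopologicalSpace G] [ChartedSpace (EuclideanSpace ℝ (Fin d)) G]
  [Group G] [LieGroup (𝓡 d) ∞ G]

/-- Left-invariance of the vector field generated by an element of the Lie algebra. -/
theorem mulInvariantVectorField_mul (X : GroupLieAlgebra (𝓡 d) G) (g h : G) :
    mulInvariantVectorField X (g * h)
      = mfderiv (𝓡 d) (𝓡 d) (fun b : G => g * b) h (mulInvariantVectorField X h) := by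
  have hsm : ∀ a : G, MDifferentiable (𝓡 d) (𝓡 d) (fun b : G => a * b) := fun a =>
    (contMDiff_mul_left (I := 𝓡 d) (n := ∞) (a := a)).mdifferentiable (by simp)
  have key : ∀ k : G, k = h → HasMFDerivAt (𝓡 d) (𝓡 d) (fun b : G => g * b) k
      (mfderiv (𝓡 d) (𝓡 d) (fun b : G => g * b) h :
        EuclideanSpace ℝ (Fin d) →L[ℝ] EuclideanSpace ℝ (Fin d)) := by
    rintro _ rfl
    exact (hsm g _).hasMFDerivAt
  have h1 := (key (h * 1) (mul_one h)).comp (1 : G) (hsm h 1).hasMFDerivAt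
  have e : (fun b : G => g * b) ∘ (fun b : G => h * b) = fun b : G => (g * h) * b := by
    ext b
    simp [mul_assoc]
  rw [e] at h1
  exact DFunLike.congr_fun h1.mfderiv X

/-- Left translates of integral curves of a left-invariant vector field are integral curves. -/
theorem isMIntegralCurveOn_mul_left (X : GroupLieAlgebra (𝓡 d) G) (g : G) {γ : ℝ → G}
    {s : Set ℝ} (hγ : IsMIntegralCurveOn γ (mulInvariantVectorField X) s) :
    IsMIntegralCurveOn (fun t => g * γ t) (mulInvariantVectorField X) s := by
  intro t ht
  have hsm : MDifferentiable (𝓡 d) (𝓡 d) (fun b : G => g * b) :=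
    (contMDiff_mul_left (I := 𝓡 d) (n := ∞) (a := g)).mdifferentiable (by simp)
  have h1 := (hsm (γ t)).hasMFDerivAt.comp_hasMFDerivWithinAt t (hγ t ht)
  have h2 : ((1 : ℝ →L[ℝ] ℝ).smulRight (mulInvariantVectorField X (g * γ t)) :
        ℝ →L[ℝ] EuclideanSpace ℝ (Fin d))
      = (mfderiv (𝓡 d) (𝓡 d) (fun b : G => g * b) (γ t)).comp
          ((1 : ℝ →L[ℝ] ℝ).smulRight (mulInvariantVectorField X (γ t))) := by
    rw [mulInvariantVectorField_mul]
    apply ContinuousLinearMap.ext_ring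
    change (1 : ℝ) • _ = (mfderiv (𝓡 d) (𝓡 d) (fun b : G => g * b) (γ t)) ((1 : ℝ) • _)
    rw [one_smul, one_smul]
  exact h2 ▸ h1

/-- Left-invariant vector fields are continuously differentiable. -/
theorem contMDiff_one_mulInvariantVectorField (X : GroupLieAlgebra (𝓡 d) G) :
    ContMDiff (𝓡 d) (𝓡 d).tangent 1
      (fun g : G => (⟨g, mulInvariantVectorField X g⟩ : TangentBundle (𝓡 d) G)) := by
  have hle : minSmoothness ℝ 3 ≤ (∞ : ℕ∞ω) := by
    simp only [minSmoothness_of_isRCLikeNormedField]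
    exact ENat.LEInfty.out
  have : LieGroup (𝓡 d) (minSmoothness ℝ 3) G := LieGroup.of_le hle
  exact (contMDiff_mulInvariantVectorField X).of_le (le_trans one_le_two le_minSmoothness)

variable [T2Space G]

/-- Every left-invariant vector field has a global integral curve through the identity. -/
theorem exists_expCurve (X : GroupLieAlgebra (𝓡 d) G) :
    ∃ γ : ℝ → G, γ 0 = 1 ∧ IsMIntegralCurve γ (mulInvariantVectorField X) := by
  have : IsManifold (𝓡 d) 1 G := IsManifold.of_le (n := ∞) ENat.LEInfty.out
  have hX := contMDiff_one_mulInvariantVectorField X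
  obtain ⟨γ, h0, hγ⟩ := exists_isMIntegralCurveAt_of_contMDiffAt_boundaryless (I := 𝓡 d) 0
    (hX (1 : G))
  obtain ⟨ε, hε, hγ⟩ := isMIntegralCurveAt_iff'.1 hγ
  refine exists_isMIntegralCurve_of_isMIntegralCurveOn hX hε (fun g => ?_) 1
  refine ⟨fun t => g * γ t, by simp [h0], ?_⟩
  have h := isMIntegralCurveOn_mul_left X g hγ
  rwa [Real.ball_eq_Ioo, zero_sub, zero_add] at h

/-- `expCurve X t` is the element `exp (tX)` of the Lie group `G`, for `X` in its Lie algebra: the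
value at time `t` of the integral curve through `1` of the left-invariant vector field of `X`. -/
def expCurve (X : GroupLieAlgebra (𝓡 d) G) : ℝ → G :=
  (exists_expCurve X).choose

theorem expCurve_zero (X : GroupLieAlgebra (𝓡 d) G) : expCurve X 0 = 1 :=
  (exists_expCurve X).choose_spec.1

theorem isMIntegralCurve_expCurve (X : GroupLieAlgebra (𝓡 d) G) :
    IsMIntegralCurve (expCurve X) (mulInvariantVectorField X) :=
  (exists_expCurve X).choose_spec.2

/-- `exp ((s + t)X) = exp (sX) exp (tX)`. -/
theorem expCurve_add (X : GroupLieAlgebra (𝓡 d) G) (s t : ℝ) :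
    expCurve X (s + t) = expCurve X s * expCurve X t := by
  have : IsManifold (𝓡 d) 1 G := IsManifold.of_le (n := ∞) ENat.LEInfty.out
  have h1 : IsMIntegralCurve (fun t => expCurve X s * expCurve X t)
      (mulInvariantVectorField X) := by
    refine isMIntegralCurve_iff_isMIntegralCurveOn.2 ?_
    exact isMIntegralCurveOn_mul_left X _ ((isMIntegralCurve_expCurve X).isMIntegralCurveOn _)
  have h2 := (isMIntegralCurve_expCurve X).comp_add s
  have h3 := isMIntegralCurve_Ioo_eq_of_contMDiff_boundaryless (t₀ := 0)
    (contMDiff_one_mulInvariantVectorField X) h2 h1 (by simp [expCurve_zero])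
  have h4 := congrFun h3 t
  simpa [add_comm] using h4

end LieExponential

section Action

variable {d : ℕ} {G : Type*} [TopologicalSpace G] [ChartedSpace (EuclideanSpace ℝ (Fin d)) G]
  [Group G] [LieGroup (𝓡 d) ∞ G] [T2Space G] {M : Type*} [MulAction G M]

/-- The vector field on `M` generated by an element `X` of the Lie algebra of `G`, as a derivation:
`(X f)(x)` is the derivative of `f (exp (tX) • x)` at `t = 0`. -/
def vectorFieldAction (X : GroupLieAlgebra (𝓡 d) G) (f : M → ℝ) : M → ℝ :=
  fun x => deriv (fun t : ℝ => f (expCurve X t • x)) 0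

/-- The second order operator `X₁² + ... + X_d²` on functions on `M`. -/
def sumOfSquares (X : Fin d → GroupLieAlgebra (𝓡 d) G) (f : M → ℝ) : M → ℝ :=
  fun x => ∑ i, vectorFieldAction (X i) (vectorFieldAction (X i) f) x

variable {𝕜 : Type*} [RCLike 𝕜] [MeasurableSpace M] {μ : Measure M} {p : ℝ≥0∞}
  [MeasurableConstSMul G M] [SMulInvariantMeasure G M μ]

/-- The one-parameter group `e^{tD_X}` of operators on `L_p(M)`: the class of `f` is sent to the
class of `x ↦ f (exp (tX) • x)`. -/
def translation (X : GroupLieAlgebra (𝓡 d) G) (t : ℝ) (f : Lp 𝕜 p μ) : Lp 𝕜 p μ :=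
  DomMulAct.mk (expCurve X t) • f

/-- `translation X t f` is represented by the function `x ↦ f (exp (tX) • x)`. -/
theorem translation_ae_eq (X : GroupLieAlgebra (𝓡 d) G) (t : ℝ) (f : Lp 𝕜 p μ) :
    translation X t f =ᵐ[μ] fun x => f (expCurve X t • x) :=
  DomMulAct.smul_Lp_ae_eq _ f

variable [Fact (1 ≤ p)]

/-- The graph of the generator `D_X` of the group `e^{tD_X}` in `L_p(M)`: `IsGenerator X f g` says
that `f` lies in the domain of `D_X` and that `D_X f = g`, that is, `(e^{tD_X} f - f) / t → g` in
the norm of `L_p(M)` as `t → 0`. -/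
def IsGenerator (X : GroupLieAlgebra (𝓡 d) G) (f g : Lp 𝕜 p μ) : Prop :=
  Tendsto (fun t : ℝ => t⁻¹ • (translation X t f - f)) (𝓝[≠] 0) (𝓝 g)

/-- `IsProduct X [i₁, ..., i_k] f g` says that `f` lies in the domain of the product
`D_{i₁} ... D_{i_k}`, where `D_i` is the generator that belongs to `X i`, and that
`D_{i₁} ... D_{i_k} f = g`. The empty product is the identity. -/
def IsProduct (X : Fin d → GroupLieAlgebra (𝓡 d) G) :
    List (Fin d) → Lp 𝕜 p μ → Lp 𝕜 p μ → Prop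
  | [], f, g => g = f
  | i :: w, f, g => ∃ h, IsProduct X w f h ∧ IsGenerator (X i) h g

/-- The Bernstein space `B^p_σ(D)`. -/
def bernsteinSpace (X : Fin d → GroupLieAlgebra (𝓡 d) G) (σ : ℝ) : Set (Lp 𝕜 p μ) :=
  {f | ∀ w : List (Fin d), ∃ g, IsProduct X w f g ∧ ‖g‖ ≤ σ ^ w.length * ‖f‖}

/-- The `j`-th term of the series in the Riesz interpolation operator. -/
def rieszTerm (σ : ℝ) (X : GroupLieAlgebra (𝓡 d) G) (f : Lp 𝕜 p μ) (j : ℤ) : Lp 𝕜 p μ :=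
  ((-1 : ℝ) ^ (j - 1) / ((j : ℝ) - 1 / 2) ^ 2) •
    translation X (Real.pi / σ * ((j : ℝ) - 1 / 2)) f

/-- The Riesz interpolation operator `R^σ` that belongs to `X`. -/
def rieszOperator (σ : ℝ) (X : GroupLieAlgebra (𝓡 d) G) (f : Lp 𝕜 p μ) : Lp 𝕜 p μ :=
  (σ / Real.pi ^ 2) • ∑' j : ℤ, rieszTerm σ X f j

/-- `rieszProduct σ X [i₁, ..., i_k] f` is `R^σ_{i₁} ... R^σ_{i_k} f`. -/
def rieszProduct (σ : ℝ) (X : Fin d → GroupLieAlgebra (𝓡 d) G) :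
    List (Fin d) → Lp 𝕜 p μ → Lp 𝕜 p μ
  | [], f => f
  | i :: w, f => rieszOperator σ (X i) (rieszProduct σ X w f)

end Action

/-- `F` is an entire function of exponential type at most `σ`. -/
def IsEntireOfExpType (F : ℂ → ℂ) (σ : ℝ) : Prop :=
  Differentiable ℂ F ∧ ∀ ε : ℝ, 0 < ε → ∃ C : ℝ, ∀ z : ℂ, ‖F z‖ ≤ C * Real.exp ((σ + ε) * ‖z‖)

/-- The function `u` of a real variable extends to an entire function of exponential type at most
`σ`, and `u` is bounded on the real line. Here `𝕜` is `ℝ` or `ℂ`, and `RCLike.map 𝕜 ℂ` is its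
canonical inclusion in `ℂ`. -/
def ExtendsBoundedExpType {𝕜 : Type*} [RCLike 𝕜] (u : ℝ → 𝕜) (σ : ℝ) : Prop :=
  (∃ F : ℂ → ℂ, IsEntireOfExpType F σ ∧ ∀ t : ℝ, F (t : ℂ) = RCLike.map 𝕜 ℂ (u t)) ∧
    ∃ B : ℝ, ∀ t : ℝ, ‖u t‖ ≤ B

end

/-!
The three conditions are linked by one fact about entire functions, the Riesz interpolation formula
`IsEntireOfExpType.hasSum_riesz`, which expresses the derivative at `0` of a function `F` of
exponential type at most `σ`, bounded on the real line, by its values at the points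
`(π / σ) (j - 1 / 2)`. The groups `e^{tD}` enter only as one-parameter groups of linear isometries;
strong continuity, which fails for `p = ∞`, is not needed, since a vector in the domain of a
generator has a norm-differentiable orbit (`IsGenerator.hasDerivAt`).

For `f` in the Bernstein space and `g = D_{i₁} ... D_{i_k} f`, the orbit of `g` under `e^{tD_j}` has
all derivatives, the `n`-th one bounded by a constant times `σ ^ n`, so its Taylor series converges
to it and is entire of exponential type at most `σ` (`exists_isEntireOfExpType`). If the orbits are
of this kind, the Riesz formula, tested against all functionals, gives `D_j g = R_j g`, and
induction on `k` gives the formula for products (`isProduct_rieszProduct`). Finally, since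
`∑ (j - 1 / 2)⁻² = π²`, the operator `R_j` has norm at most `σ` (`norm_rieszOperator_le`), so the
interpolation formula implies the Bernstein inequalities.

The Riesz formula is reduced to `σ = π`. By Phragmén–Lindelöf, `|F z| ≤ B exp (π |Im z|)`
(`IsEntireOfExpType.norm_le_mul_exp_abs_im`). The function `g z = (F z - F 0) / z` is entire and
smaller than this bound by a factor `|z|`, hence the integral of `g z / (z cos (π z))` over the
circle `|z| = N` tends to zero. By the Cauchy formula, applied after subtracting from `g` the finite
interpolating sum at the half-integers in the disc, this integral is, up to `2πi`, the difference
of `g 0 = F' 0` and the value of that sum at `0` (`norm_sub_sum_half_integers_le`). The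
contributions of `F 0` cancel in pairs. The value `π²` of `∑ (j - 1 / 2)⁻²` is the case
`F z = sin (π z)` of the formula itself.
-/

/-! ### Entire functions of exponential type that are bounded on the real line -/

theorem norm_le_mul_exp_im_of_im_nonneg {F : ℂ → ℂ} (hF : Differentiable ℂ F) {τ B C : ℝ}
    (hτ : 0 ≤ τ) (hC : ∀ z, ‖F z‖ ≤ C * Real.exp (τ * ‖z‖)) (hB : ∀ x : ℝ, ‖F x‖ ≤ B)
    {z : ℂ} (hz : 0 ≤ z.im) : ‖F z‖ ≤ B * Real.exp (τ * z.im) := by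
  have hC0 : 0 ≤ C := by simpa using (norm_nonneg _).trans (hC 0)
  -- The quarter turn `w ↦ I * w` carries the right half-plane to the upper one.
  set f : ℂ → ℂ := fun w => Complex.exp (-τ * w) * F (Complex.I * w) with hf
  have hnorm : ∀ w, ‖f w‖ = Real.exp (-τ * w.re) * ‖F (Complex.I * w)‖ := by
    intro w
    simp [hf, Complex.norm_exp]
  have hfle : ∀ w : ℂ, ‖f w‖ ≤ C * Real.exp (τ * (‖w‖ - w.re)) := by
    intro w
    rw [hnorm]
    calc Real.exp (-τ * w.re) * ‖F (Complex.I * w)‖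
        ≤ Real.exp (-τ * w.re) * (C * Real.exp (τ * ‖Complex.I * w‖)) := by
          gcongr
          exact hC _
      _ = C * Real.exp (τ * (‖w‖ - w.re)) := by
          rw [mul_left_comm, ← Real.exp_add]
          simp only [norm_mul, Complex.norm_I, one_mul]
          ring_nf
  have hfd : Differentiable ℂ f := by
    rw [hf]
    fun_prop
  have key : ‖f (-Complex.I * z)‖ ≤ B := by
    refine PhragmenLindelof.right_half_plane_of_bounded_on_real hfd.diffContOnCl
      ⟨1, by norm_num, 2 * τ, ?_⟩ ?_ ?_ (by simpa using hz)
    · refine Asymptotics.IsBigO.of_bound C (Eventually.of_forall fun w => (hfle w).trans ?_)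
      rw [Real.norm_of_nonneg (Real.exp_pos _).le, Real.rpow_one]
      have := Complex.abs_re_le_norm w
      have := neg_abs_le w.re
      refine mul_le_mul_of_nonneg_left (Real.exp_le_exp.2 ?_) hC0
      nlinarith
    · refine ⟨C, eventually_map.2 ?_⟩
      filter_upwards [eventually_ge_atTop 0] with x hx
      refine (hfle x).trans (le_of_eq ?_)
      simp [abs_of_nonneg hx]
    · intro x
      rw [hnorm]
      have h : Complex.I * (x * Complex.I) = ((-x : ℝ) : ℂ) := by
        push_cast
        linear_combination (x : ℂ) * Complex.I_mul_I
      rw [h]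
      simpa using hB (-x)
  rw [hnorm] at key
  have h : Complex.I * (-Complex.I * z) = z := by
    linear_combination -z * Complex.I_mul_I
  rw [h] at key
  have h2 : (-Complex.I * z).re = z.im := by simp
  rw [h2, neg_mul, Real.exp_neg, inv_mul_le_iff₀ (Real.exp_pos _)] at key
  linarith

/-- An entire function of exponential type at most `σ` that is bounded by `B` on the real line is
bounded by `B * exp (σ * |Im z|)`, by the Phragmén–Lindelöf principle. -/
theorem IsEntireOfExpType.norm_le_mul_exp_abs_im {F : ℂ → ℂ} {σ B : ℝ} (hσ : 0 ≤ σ)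
    (hF : IsEntireOfExpType F σ) (hB : ∀ x : ℝ, ‖F x‖ ≤ B) (z : ℂ) :
    ‖F z‖ ≤ B * Real.exp (σ * |z.im|) := by
  have key : ∀ ε : ℝ, 0 < ε → ‖F z‖ ≤ B * Real.exp ((σ + ε) * |z.im|) := by
    intro ε hε
    obtain ⟨C, hC⟩ := hF.2 ε hε
    rcases le_total 0 z.im with hz | hz
    · rw [abs_of_nonneg hz]
      exact norm_le_mul_exp_im_of_im_nonneg hF.1 (by positivity) hC hB hz
    · rw [abs_of_nonpos hz]
      have hd : Differentiable ℂ fun w => F (-w) := hF.1.comp differentiable_neg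
      have := norm_le_mul_exp_im_of_im_nonneg hd (τ := σ + ε) (B := B) (C := C) (by positivity)
        (fun w => by simpa using hC (-w)) (fun x => by simpa using hB (-x))
        (z := -z) (by simpa using hz)
      simpa using this
  have hlim : Tendsto (fun ε : ℝ => B * Real.exp ((σ + ε) * |z.im|)) (𝓝[>] 0)
      (𝓝 (B * Real.exp (σ * |z.im|))) :=
    tendsto_nhdsWithin_of_tendsto_nhds (Continuous.tendsto' (by fun_prop) _ _ (by simp))
  exact ge_of_tendsto hlim (eventually_nhdsWithin_of_forall key)

/-! ### The function `cos (π z)` -/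

theorem Complex.norm_sin_le_exp_abs_im (z : ℂ) : ‖Complex.sin z‖ ≤ Real.exp |z.im| := by
  rw [Complex.sin, norm_div, norm_mul, Complex.norm_I, mul_one]
  have h1 : ‖Complex.exp (-z * Complex.I)‖ ≤ Real.exp |z.im| := by
    rw [Complex.norm_exp]
    simpa using le_abs_self z.im
  have h2 : ‖Complex.exp (z * Complex.I)‖ ≤ Real.exp |z.im| := by
    rw [Complex.norm_exp]
    simpa using neg_le_abs z.im
  have h3 := norm_sub_le (Complex.exp (-z * Complex.I)) (Complex.exp (z * Complex.I))
  rw [div_le_iff₀ (by simp)]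
  simp only [Complex.norm_ofNat]
  linarith

theorem Complex.norm_cos_sq (z : ℂ) :
    ‖Complex.cos z‖ ^ 2 = Real.cosh z.im ^ 2 - Real.sin z.re ^ 2 := by
  have h : Complex.cos z = ⟨Real.cos z.re * Real.cosh z.im, -(Real.sin z.re * Real.sinh z.im)⟩ := by
    rw [Complex.cos_eq z]
    apply Complex.ext <;> simp [← Complex.ofReal_cos, ← Complex.ofReal_sin, ← Complex.ofReal_cosh,
      ← Complex.ofReal_sinh]
  rw [h, Complex.sq_norm, Complex.normSq_mk]
  have h1 := Real.cosh_sq z.im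
  have h2 := Real.sin_sq_add_cos_sq z.re
  linear_combination Real.cosh z.im ^ 2 * h2 - Real.sin z.re ^ 2 * h1

/-- On circles about `0` of positive integer radius, which keep away from the zeros of `cos (π z)`,
this function is as large as `exp (π * |Im z|)`, up to a constant factor. -/
theorem exp_le_four_mul_norm_cos_pi_mul {N : ℕ} (hN : 0 < N) {z : ℂ} (hz : ‖z‖ = N) :
    Real.exp (Real.pi * |z.im|) ≤ 4 * ‖Complex.cos (Real.pi * z)‖ := by
  have hN1 : (1 : ℝ) ≤ N := by exact_mod_cast hN
  have hpi := Real.pi_gt_three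
  have hpi4 := Real.pi_le_four
  have hsq := Complex.norm_cos_sq (Real.pi * z)
  have him : (Real.pi * z).im = Real.pi * z.im := by simp
  have hre : (Real.pi * z).re = Real.pi * z.re := by simp
  rw [him, hre] at hsq
  rw [← Real.cosh_abs, abs_mul, abs_of_pos Real.pi_pos] at hsq
  set b := Real.pi * |z.im| with hb
  have hcosh : Real.exp b ≤ 2 * Real.cosh b := by
    rw [Real.cosh_eq]
    have := Real.exp_pos (-b)
    linarith
  refine le_of_sq_le_sq ?_ (by positivity)
  rw [mul_pow, hsq]
  rcases le_total (1 / 4) |z.im| with h | h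
  · have hs : Real.exp b ≤ 4 * Real.sinh b := by
      rw [Real.sinh_eq]
      have h1 : Real.exp (-b) * Real.exp b = 1 := by rw [← Real.exp_add]; simp
      have h2 : 1 + b ≤ Real.exp b := by linarith [Real.add_one_le_exp b]
      have h3 : 3 / 4 ≤ b := by rw [hb]; nlinarith
      have h4 := Real.exp_pos (-b)
      nlinarith
    have h1 := Real.cosh_sq b
    have h2 := Real.sin_sq_le_one (Real.pi * z.re)
    have h3 := Real.exp_pos b
    nlinarith
  · -- Here `|Re z|` is within `1 / 16` of the integer `N`.
    have h1 : |z.re| ^ 2 + |z.im| ^ 2 = (N : ℝ) ^ 2 := by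
      rw [← hz, Complex.sq_norm, Complex.normSq_apply, sq_abs, sq_abs]
      ring
    have h0 := abs_nonneg z.im
    have hle : |z.re| ≤ N := hz ▸ Complex.abs_re_le_norm z
    have h2 : (N : ℝ) - |z.re| ≤ 1 / 16 := by
      have := abs_nonneg z.re
      nlinarith
    have h3 : Real.sin (Real.pi * z.re) ^ 2 = Real.sin (Real.pi * (N - |z.re|)) ^ 2 := by
      have e : Real.pi * (N - |z.re|) = N * Real.pi - Real.pi * |z.re| := by ring
      rw [e, Real.sin_nat_mul_pi_sub, neg_sq, mul_pow, ← pow_mul, mul_comm N 2, pow_mul]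
      rcases abs_cases z.re with h | h <;> simp [h.1]
    have h4 : |Real.sin (Real.pi * (N - |z.re|))| ≤ |Real.pi * (N - |z.re|)| :=
      Real.abs_sin_le_abs
    have h5 : |Real.pi * (N - |z.re|)| ≤ 1 / 4 := by
      rw [abs_of_nonneg (mul_nonneg Real.pi_pos.le (by linarith))]
      nlinarith
    have h6 : Real.sin (Real.pi * (N - |z.re|)) ^ 2 ≤ 1 / 2 := by
      rw [← sq_abs]
      have := abs_nonneg (Real.sin (Real.pi * (N - |z.re|)))
      nlinarith
    have h7 := Real.one_le_cosh b
    have h8 := Real.exp_pos b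
    rw [h3]
    nlinarith

theorem Complex.cos_pi_mul_eq_zero_iff {z : ℂ} :
    Complex.cos (Real.pi * z) = 0 ↔ ∃ k : ℤ, z = k + 1 / 2 := by
  have hpi : (Real.pi : ℂ) ≠ 0 := by exact_mod_cast Real.pi_ne_zero
  rw [Complex.cos_eq_zero_iff]
  refine exists_congr fun k => ⟨fun h => ?_, fun h => ?_⟩
  · apply mul_left_cancel₀ hpi
    linear_combination h
  · rw [h]
    ring

theorem Complex.hasDerivAt_cos_pi_mul_half_integer (k : ℤ) :
    HasDerivAt (fun z : ℂ => Complex.cos (Real.pi * z)) (-(Real.pi * (-1) ^ k)) (k + 1 / 2) := by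
  have h := ((hasDerivAt_id ((k : ℂ) + 1 / 2)).const_mul (Real.pi : ℂ)).ccos
  have e : (Real.pi : ℂ) * id ((k : ℂ) + 1 / 2) = k * Real.pi + Real.pi / 2 := by
    simp only [id]
    ring
  have e2 : Complex.cos (k * Real.pi) = (-1) ^ k := by
    have e3 : (k : ℂ) * Real.pi = ((k * Real.pi : ℝ) : ℂ) := by push_cast; rfl
    rw [e3, ← Complex.ofReal_cos, Real.cos_int_mul_pi]
    simp
  simp only [e, Complex.sin_add_pi_div_two, e2] at h
  refine h.congr_deriv ?_
  ring

/-! ### Interpolation at the half-integers -/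

/-- The Cauchy integral formula on `|z| = N` for the quotient of an entire function by `cos (π z)`:
if `h` vanishes at the half-integers of the disc, the quotient extends continuously over the
zeros of the cosine. -/
theorem circleIntegral_inv_mul_div_cos {N : ℕ} (hN : 0 < N) {h : ℂ → ℂ} (hd : Differentiable ℂ h)
    (h0 : ∀ k ∈ Finset.Ico (-(N : ℤ)) N, h (k + 1 / 2) = 0) :
    (∮ z in C(0, N), z⁻¹ * (h z / Complex.cos (Real.pi * z))) = 2 * Real.pi * Complex.I * h 0 := by
  classical
  have hN0 : (0 : ℝ) < N := by exact_mod_cast hN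
  set c : ℂ → ℂ := fun z => Complex.cos (Real.pi * z) with hc
  have hcd : Differentiable ℂ c := by
    rw [hc]
    fun_prop
  set E : ℂ → ℂ := fun z => if c z = 0 then deriv h z / deriv c z else h z / c z with hE
  have hEne : ∀ z, c z ≠ 0 → E =ᶠ[𝓝 z] fun w => h w / c w := fun z hz => by
    filter_upwards [hcd.continuous.continuousAt.eventually_ne hz] with w hw
    simp [hE, hw]
  have hdiff : ∀ z, c z ≠ 0 → DifferentiableAt ℂ E z := fun z hz =>
    ((hd z).div (hcd z) hz).congr_of_eventuallyEq (hEne z hz)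
  have hcount : {z | c z = 0}.Countable := by
    refine (Set.countable_range fun k : ℤ => (k : ℂ) + 1 / 2).mono fun z hz => ?_
    obtain ⟨k, hk⟩ := Complex.cos_pi_mul_eq_zero_iff.1 hz
    exact ⟨k, hk.symm⟩
  have hcont : ∀ z ∈ Metric.closedBall (0 : ℂ) N, ContinuousAt E z := by
    intro z hz
    by_cases hz0 : c z = 0
    · obtain ⟨k, rfl⟩ := Complex.cos_pi_mul_eq_zero_iff.1 hz0
      have hk : k ∈ Finset.Ico (-(N : ℤ)) N := by
        have e : ((k : ℂ) + 1 / 2) = ((k + 1 / 2 : ℝ) : ℂ) := by push_cast; ring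
        rw [mem_closedBall_zero_iff, e, Complex.norm_real, Real.norm_eq_abs, abs_le] at hz
        rw [Finset.mem_Ico]
        constructor
        · have : (-(N : ℤ) : ℝ) < k + 1 := by push_cast; linarith [hz.1]
          have : -(N : ℤ) < k + 1 := by exact_mod_cast this
          omega
        · have : (k : ℝ) < N := by linarith [hz.2]
          exact_mod_cast this
      have hh := h0 k hk
      set a : ℂ := k + 1 / 2
      have hda := Complex.hasDerivAt_cos_pi_mul_half_integer k
      have hne : deriv c a ≠ 0 := by
        rw [hda.deriv]
        exact neg_ne_zero.2 (mul_ne_zero (by simp [Real.pi_ne_zero]) (zpow_ne_zero _ (by simp)))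
      have hq : ContinuousAt (fun w => dslope h a w / dslope c a w) a := by
        refine (continuousAt_dslope_same.2 (hd a)).div (continuousAt_dslope_same.2 (hcd a)) ?_
        rwa [dslope_same]
      refine hq.congr ?_
      have hev : ∀ᶠ w in 𝓝 a, dslope c a w ≠ 0 :=
        (continuousAt_dslope_same.2 (hcd a)).eventually_ne (by rwa [dslope_same])
      filter_upwards [hev] with w hw
      by_cases hwa : w = a
      · simp [hE, hwa, hz0]
      · have h1 := sub_smul_dslope_of_zero (f := h) hh w
        have h2 := sub_smul_dslope_of_zero (f := c) hz0 w
        have hwa' : w - a ≠ 0 := sub_ne_zero.2 hwa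
        have hcw : c w ≠ 0 := by
          rw [← h2]
          exact mul_ne_zero hwa' hw
        simp only [hE, hcw, if_false]
        rw [← h1, ← h2, smul_eq_mul, smul_eq_mul, mul_div_mul_left _ _ hwa']
    · exact (hdiff z hz0).continuousAt
  have hcauchy := Complex.circleIntegral_sub_inv_smul_of_differentiable_on_off_countable
    (R := N) (c := 0) (w := 0) (f := E) hcount (Metric.mem_ball_self hN0)
    (fun z hz => (hcont z hz).continuousWithinAt) (fun z hz => hdiff z hz.2)
  have hE0 : E 0 = h 0 := by simp [hE, hc]
  rw [hE0, smul_eq_mul] at hcauchy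
  rw [← hcauchy]
  refine circleIntegral.integral_congr hN0.le fun z hz => ?_
  have hcz : c z ≠ 0 := by
    intro h
    have h1 := exp_le_four_mul_norm_cos_pi_mul hN (by simpa using hz)
    change Complex.cos (Real.pi * z) = 0 at h
    rw [h, norm_zero, mul_zero] at h1
    exact absurd (Real.exp_pos _) h1.not_gt
  simp only [hE, hcz, if_false, sub_zero, smul_eq_mul]
  rfl

theorem circleIntegral_inv_mul_inv_sub_eq_zero {R : ℝ} {a : ℂ} (ha : a ≠ 0)
    (haR : ‖a‖ < R) : (∮ z in C(0, R), z⁻¹ * (z - a)⁻¹) = 0 := by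
  have hR : 0 < R := (norm_nonneg a).trans_lt haR
  have hne : ∀ w ∈ Metric.ball (0 : ℂ) R, ∀ z ∈ Metric.sphere (0 : ℂ) R, z - w ≠ 0 := by
    intro w hw z hz h
    rw [sub_eq_zero] at h
    rw [mem_sphere_zero_iff_norm] at hz
    rw [mem_ball_zero_iff, ← h, hz] at hw
    exact lt_irrefl _ hw
  have h0 := circleIntegral.integral_sub_inv_of_mem_ball (Metric.mem_ball_self (x := (0 : ℂ)) hR)
  have h1 := circleIntegral.integral_sub_inv_of_mem_ball
    (show a ∈ Metric.ball (0 : ℂ) R by simpa using haR)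
  have hi : ∀ w ∈ Metric.ball (0 : ℂ) R, CircleIntegrable (fun z => (z - w)⁻¹) 0 R := by
    intro w hw
    refine ContinuousOn.circleIntegrable hR.le ?_
    exact (continuousOn_id.sub continuousOn_const).inv₀ (hne w hw)
  have e : (∮ z in C(0, R), z⁻¹ * (z - a)⁻¹)
      = ∮ z in C(0, R), a⁻¹ * ((z - a)⁻¹ - (z - 0)⁻¹) := by
    refine circleIntegral.integral_congr hR.le fun z hz => ?_
    have h1 := hne a (by simpa using haR) z hz
    have h2 := hne 0 (Metric.mem_ball_self hR) z hz
    rw [sub_zero] at h2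
    simp only [sub_zero]
    field_simp
    ring
  rw [e, circleIntegral.integral_const_mul, circleIntegral.integral_sub
    (hi a (by simpa using haR)) (hi 0 (Metric.mem_ball_self hR)), h0, h1, sub_self, mul_zero]

/-- The truncated interpolation formula for the value at `0` of an entire function `g` whose size is
`exp (π * |Im z|) / |z|`, with the rate at which the error tends to zero. -/
theorem norm_sub_sum_half_integers_le {g : ℂ → ℂ} (hg : Differentiable ℂ g) {B : ℝ}
    (hB : ∀ z, ‖z‖ * ‖g z‖ ≤ B * Real.exp (Real.pi * |z.im|)) {N : ℕ} (hN : 0 < N) :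
    ‖g 0 - ∑ k ∈ Finset.Ico (-(N : ℤ)) N, (-1) ^ k / (Real.pi * (k + 1 / 2)) * g (k + 1 / 2)‖
      ≤ 4 * B / N := by
  have hN0 : (0 : ℝ) < N := by exact_mod_cast hN
  have hpi : (Real.pi : ℂ) ≠ 0 := by exact_mod_cast Real.pi_ne_zero
  have hB0 : 0 ≤ B := by simpa using hB 0
  have ha0 : ∀ k : ℤ, ((k : ℂ) + 1 / 2) ≠ 0 := by
    intro k h
    have h1 : (2 * k + 1 : ℂ) = 0 := by linear_combination 2 * h
    have h2 : (2 * k + 1 : ℤ) = 0 := by exact_mod_cast h1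
    omega
  set c : ℂ → ℂ := fun z => Complex.cos (Real.pi * z) with hc
  have hcd : Differentiable ℂ c := by
    rw [hc]
    fun_prop
  have hck : ∀ k : ℤ, c (k + 1 / 2) = 0 := fun k => Complex.cos_pi_mul_eq_zero_iff.2 ⟨k, rfl⟩
  have hc' : ∀ k : ℤ, deriv c (k + 1 / 2) = -(Real.pi * (-1) ^ k) := fun k =>
    (Complex.hasDerivAt_cos_pi_mul_half_integer k).deriv
  have hsq : ∀ k : ℤ, ((-1 : ℂ) ^ k) * (-1) ^ k = 1 := by
    intro k
    rw [← mul_zpow]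
    simp
  set S := Finset.Ico (-(N : ℤ)) N
  -- `b k` is `g (k + 1 / 2)` divided by the derivative of the cosine at `k + 1 / 2`.
  set b : ℤ → ℂ := fun k => -((-1) ^ k / Real.pi) * g (k + 1 / 2) with hb
  set h : ℂ → ℂ := fun z => g z - ∑ k ∈ S, b k * dslope c (k + 1 / 2) z with hh
  have hds : ∀ k : ℤ, Differentiable ℂ (dslope c (k + 1 / 2)) := fun k =>
    differentiableOn_univ.1
      ((Complex.differentiableOn_dslope univ_mem).2 hcd.differentiableOn)
  have hhd : Differentiable ℂ h := by
    rw [hh]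
    refine hg.sub (Differentiable.fun_sum fun k _ => (hds k).const_mul _)
  have hdsne : ∀ (k : ℤ) (z : ℂ), z ≠ k + 1 / 2 →
      dslope c (k + 1 / 2) z = c z * (z - (k + 1 / 2))⁻¹ := by
    intro k z hz
    have h1 := sub_smul_dslope_of_zero (f := c) (hck k) z
    rw [smul_eq_mul] at h1
    rw [← h1]
    rw [mul_comm, inv_mul_cancel_left₀ (sub_ne_zero.2 hz)]
  have hh0 : ∀ k ∈ S, h (k + 1 / 2) = 0 := by
    intro k hk
    have hz : ∀ l ∈ S, l ≠ k → b l * dslope c (l + 1 / 2) (k + 1 / 2) = 0 := by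
      intro l _ hl
      rw [hdsne l _ (by simpa using hl.symm), hck, zero_mul, mul_zero]
    simp only [hh]
    rw [Finset.sum_eq_single_of_mem k hk hz, dslope_same, hc', hb]
    simp only
    have e : -((-1) ^ k / (Real.pi : ℂ)) * g (k + 1 / 2) * -(Real.pi * (-1) ^ k)
        = ((-1) ^ k * (-1) ^ k) * g (k + 1 / 2) := by
      generalize g (k + 1 / 2) = w
      field_simp
    rw [e, hsq, one_mul, sub_self]
  have hint := circleIntegral_inv_mul_div_cos hN hhd hh0
  have hval : h 0 = g 0 - ∑ k ∈ S, (-1) ^ k / (Real.pi * (k + 1 / 2)) * g (k + 1 / 2) := by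
    simp only [hh]
    congr 1
    refine Finset.sum_congr rfl fun k _ => ?_
    rw [hdsne k 0 (ha0 k).symm]
    have h1 := ha0 k
    have h2 : c 0 = 1 := by simp [hc]
    rw [h2, zero_sub, inv_neg, one_mul, hb]
    simp only
    field_simp
  have hcz : ∀ z ∈ Metric.sphere (0 : ℂ) N, c z ≠ 0 := by
    intro z hz h
    have h1 := exp_le_four_mul_norm_cos_pi_mul hN (by simpa using hz)
    change Complex.cos (Real.pi * z) = 0 at h
    rw [h, norm_zero, mul_zero] at h1
    exact absurd (Real.exp_pos _) h1.not_gt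
  have hz0 : ∀ z ∈ Metric.sphere (0 : ℂ) N, z ≠ 0 := fun z hz =>
    ne_zero_of_mem_sphere hN0.ne' ⟨z, hz⟩
  have hza : ∀ z ∈ Metric.sphere (0 : ℂ) N, ∀ k : ℤ, z ≠ k + 1 / 2 := fun z hz k h =>
    hcz z hz (h ▸ hck k)
  have hig : CircleIntegrable (fun z => z⁻¹ * (g z / c z)) 0 N :=
    ContinuousOn.circleIntegrable hN0.le ((continuousOn_id.inv₀ hz0).mul
      (hg.continuous.continuousOn.div hcd.continuous.continuousOn hcz))
  have hik : ∀ k ∈ S, CircleIntegrable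
      (fun z => b k * (z⁻¹ * (z - (k + 1 / 2))⁻¹)) 0 N := fun k _ =>
    ContinuousOn.circleIntegrable hN0.le (continuousOn_const.mul ((continuousOn_id.inv₀ hz0).mul
      ((continuousOn_id.sub continuousOn_const).inv₀ fun z hz => sub_ne_zero.2 (hza z hz k))))
  have hsplit : (∮ z in C(0, N), z⁻¹ * (h z / c z))
      = (∮ z in C(0, N), z⁻¹ * (g z / c z)) := by
    have e : (∮ z in C(0, N), z⁻¹ * (h z / c z)) = ∮ z in C(0, N), (z⁻¹ * (g z / c z)
        - ∑ k ∈ S, b k * (z⁻¹ * (z - (k + 1 / 2))⁻¹)) := by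
      refine circleIntegral.integral_congr hN0.le fun z hz => ?_
      simp only [hh]
      rw [sub_div, mul_sub, Finset.sum_div, Finset.mul_sum]
      congr 1
      refine Finset.sum_congr rfl fun k _ => ?_
      rw [hdsne k z (hza z hz k)]
      have := hcz z hz
      field_simp
    have hsum : (∮ z in C(0, N), ∑ k ∈ S, b k * (z⁻¹ * (z - (k + 1 / 2))⁻¹)) = 0 := by
      rw [circleIntegral.integral_fun_sum hik]
      refine Finset.sum_eq_zero fun k hk => ?_
      rw [circleIntegral.integral_const_mul,
        circleIntegral_inv_mul_inv_sub_eq_zero (ha0 k), mul_zero]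
      have ec : ((k : ℂ) + 1 / 2) = ((k + 1 / 2 : ℝ) : ℂ) := by push_cast; ring
      rw [Finset.mem_Ico] at hk
      have h1 : (-(N : ℝ)) ≤ k := by exact_mod_cast hk.1
      have h2 : (k : ℝ) + 1 ≤ N := by exact_mod_cast hk.2
      rw [ec, Complex.norm_real, Real.norm_eq_abs, abs_lt]
      constructor <;> linarith
    rw [e, circleIntegral.integral_sub hig (CircleIntegrable.fun_sum S hik), hsum, sub_zero]
  have hbound := circleIntegral.norm_two_pi_i_inv_smul_integral_le_of_norm_le_const
    (f := fun z => z⁻¹ * (g z / c z)) (c := 0) (C := 4 * B / (N * N)) hN0.le ?_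
  · rw [← hval]
    have e : h 0 = (2 * Real.pi * Complex.I : ℂ)⁻¹ • ∮ z in C(0, N), z⁻¹ * (g z / c z) := by
      rw [← hsplit, hint, smul_eq_mul]
      field_simp
    rw [e]
    refine hbound.trans (le_of_eq ?_)
    field_simp
  · intro z hz
    have hzN : ‖z‖ = N := by simpa using hz
    have h1 := exp_le_four_mul_norm_cos_pi_mul hN hzN
    have h2 := hB z
    have h3 : 0 < ‖c z‖ := norm_pos_iff.2 (hcz z hz)
    rw [hzN] at h2
    rw [norm_mul, norm_inv, norm_div, hzN, ← div_eq_inv_mul, div_div, div_le_div_iff₀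
      (by positivity) (by positivity)]
    have h4 : N * ‖g z‖ ≤ B * (4 * ‖c z‖) := h2.trans (mul_le_mul_of_nonneg_left h1 hB0)
    calc ‖g z‖ * (N * N) = (N * ‖g z‖) * N := by ring
      _ ≤ (B * (4 * ‖c z‖)) * N := by gcongr
      _ = _ := by ring

/-! ### The Riesz interpolation formula -/

theorem summable_one_div_half_integer_sq :
    Summable fun k : ℤ => 1 / ((k : ℝ) + 1 / 2) ^ 2 := by
  refine ((Real.summable_one_div_int_add_rpow (1 / 2) 2).2 one_lt_two).congr fun k => ?_
  rw [Real.rpow_two, sq_abs]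

theorem norm_neg_one_zpow_div_half_integer_sq (k : ℤ) :
    ‖((-1 : ℂ) ^ k / (k + 1 / 2) ^ 2)‖ = 1 / ((k : ℝ) + 1 / 2) ^ 2 := by
  have ec : ((k : ℂ) + 1 / 2) = ((k + 1 / 2 : ℝ) : ℂ) := by push_cast; ring
  rw [norm_div, norm_zpow, norm_neg, norm_one, one_zpow, norm_pow, ec, Complex.norm_real,
    Real.norm_eq_abs, sq_abs]

theorem summable_neg_one_zpow_div_half_integer_sq :
    Summable fun k : ℤ => (-1 : ℂ) ^ k / (k + 1 / 2) ^ 2 :=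
  Summable.of_norm (summable_one_div_half_integer_sq.congr fun k =>
    (norm_neg_one_zpow_div_half_integer_sq k).symm)

/-- The terms with indices `k` and `-1 - k` cancel. -/
theorem tsum_neg_one_zpow_div_half_integer_sq :
    ∑' k : ℤ, (-1 : ℂ) ^ k / (k + 1 / 2) ^ 2 = 0 := by
  have h := (Equiv.subLeft (-1 : ℤ)).tsum_eq fun k : ℤ => (-1 : ℂ) ^ k / (k + 1 / 2) ^ 2
  have e : ∀ k : ℤ, (-1 : ℂ) ^ (Equiv.subLeft (-1 : ℤ) k)
      / (((Equiv.subLeft (-1 : ℤ) k : ℤ) : ℂ) + 1 / 2) ^ 2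
        = -((-1 : ℂ) ^ k / (k + 1 / 2) ^ 2) := by
    intro k
    have h1 : (-1 : ℂ) ^ (-1 - k) = -(-1) ^ k := by
      rw [zpow_sub₀ (by simp), div_eq_mul_inv, ← inv_zpow]
      simp
    rw [Equiv.subLeft_apply, h1, neg_div]
    congr 2
    push_cast
    ring
  rw [tsum_congr e, tsum_neg] at h
  exact self_eq_neg.1 h.symm

/-- The Riesz interpolation formula at the origin for type `π`. -/
theorem hasSum_half_integers_deriv {F : ℂ → ℂ} (hF : Differentiable ℂ F) {B : ℝ}
    (hB : ∀ z, ‖F z‖ ≤ B * Real.exp (Real.pi * |z.im|)) :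
    HasSum (fun k : ℤ => (-1 : ℂ) ^ k / (k + 1 / 2) ^ 2 * F (k + 1 / 2))
      (Real.pi * deriv F 0) := by
  have hpi : (Real.pi : ℂ) ≠ 0 := by exact_mod_cast Real.pi_ne_zero
  have hsum : Summable fun k : ℤ => (-1 : ℂ) ^ k / (k + 1 / 2) ^ 2 * F (k + 1 / 2) := by
    refine Summable.of_norm_bounded (summable_one_div_half_integer_sq.mul_right B) fun k => ?_
    rw [norm_mul, norm_neg_one_zpow_div_half_integer_sq]
    gcongr
    simpa using hB (k + 1 / 2)
  -- By the cancellation, `F` may be replaced by `F - F 0`, which is divisible by `z`.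
  have hsum0 := hsum.hasSum.sub
    ((summable_neg_one_zpow_div_half_integer_sq.hasSum).mul_right (F 0))
  rw [tsum_neg_one_zpow_div_half_integer_sq, zero_mul, sub_zero] at hsum0
  have hlim := hsum0.comp (Finset.tendsto_Ico_neg (R := ℤ))
  set g : ℂ → ℂ := dslope F 0 with hg
  have hgd : Differentiable ℂ g := differentiableOn_univ.1
    ((Complex.differentiableOn_dslope univ_mem).2 hF.differentiableOn)
  have hgz : ∀ z, z * g z = F z - F 0 := fun z => by
    simpa using sub_smul_dslope F 0 z
  have hB0 : 0 ≤ B := by simpa using (norm_nonneg _).trans (hB 0)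
  have hgB : ∀ z, ‖z‖ * ‖g z‖ ≤ (2 * B) * Real.exp (Real.pi * |z.im|) := by
    intro z
    rw [← norm_mul, hgz]
    have h1 := norm_sub_le (F z) (F 0)
    have h2 := hB z
    have h3 : ‖F 0‖ ≤ B := by simpa using hB 0
    have h4 : (1 : ℝ) ≤ Real.exp (Real.pi * |z.im|) := Real.one_le_exp (by positivity)
    nlinarith
  have htrunc : Tendsto (fun N : ℕ => ∑ k ∈ Finset.Ico (-(N : ℤ)) N,
      (-1 : ℂ) ^ k / (Real.pi * (k + 1 / 2)) * g (k + 1 / 2)) atTop (𝓝 (g 0)) := by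
    rw [tendsto_iff_norm_sub_tendsto_zero]
    refine squeeze_zero' (Eventually.of_forall fun _ => norm_nonneg _) ?_
      (tendsto_const_div_atTop_nhds_zero_nat (4 * (2 * B)))
    filter_upwards [eventually_gt_atTop 0] with N hN
    rw [norm_sub_rev]
    exact norm_sub_sum_half_integers_le hgd hgB hN
  have hlim2 := htrunc.const_mul (Real.pi : ℂ)
  have heq : ∑' k : ℤ, (-1 : ℂ) ^ k / (k + 1 / 2) ^ 2 * F (k + 1 / 2) = Real.pi * g 0 := by
    refine tendsto_nhds_unique hlim (hlim2.congr fun N => ?_)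
    rw [Finset.mul_sum]
    refine Finset.sum_congr rfl fun k _ => ?_
    have ha0 : ((k : ℂ) + 1 / 2) ≠ 0 := by
      intro h
      have h1 : (2 * k + 1 : ℂ) = 0 := by linear_combination 2 * h
      have h2 : (2 * k + 1 : ℤ) = 0 := by exact_mod_cast h1
      omega
    beta_reduce
    rw [← mul_sub, ← hgz]
    generalize g (k + 1 / 2) = w
    generalize (k : ℂ) + 1 / 2 = a at ha0
    field_simp
  rw [hg, dslope_same] at heq
  exact heq ▸ hsum.hasSum

/-- `∑ 1 / (j - 1 / 2) ^ 2 = π ^ 2`: the Riesz formula for the function `sin (π z)`, which takes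
the values `± 1` at the half-integers. -/
theorem hasSum_one_div_sub_half_sq :
    HasSum (fun j : ℤ => 1 / ((j : ℝ) - 1 / 2) ^ 2) (Real.pi ^ 2) := by
  have hd : ∀ z : ℂ, HasDerivAt (fun z : ℂ => Complex.sin (Real.pi * z))
      (Complex.cos (Real.pi * z) * Real.pi) z := fun z => by
    simpa using ((hasDerivAt_id z).const_mul (Real.pi : ℂ)).csin
  have h := hasSum_half_integers_deriv (F := fun z => Complex.sin (Real.pi * z)) (B := 1)
    (fun z => (hd z).differentiableAt) (fun z => by
      have := Complex.norm_sin_le_exp_abs_im (Real.pi * z)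
      rw [Complex.im_ofReal_mul, abs_mul, abs_of_pos Real.pi_pos] at this
      simpa using this)
  rw [(hd 0).deriv, mul_zero, Complex.cos_zero, one_mul] at h
  have h2 : HasSum (fun k : ℤ => 1 / ((k : ℝ) + 1 / 2) ^ 2) (Real.pi ^ 2) := by
    refine Complex.hasSum_ofReal.1 ?_
    push_cast
    rw [sq]
    refine h.congr_fun fun k => ?_
    have e : (Real.pi : ℂ) * (k + 1 / 2) = ((k * Real.pi + Real.pi / 2 : ℝ) : ℂ) := by
      push_cast
      ring
    have e2 : Complex.sin (Real.pi * (k + 1 / 2)) = (-1) ^ k := by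
      rw [e, ← Complex.ofReal_sin, Real.sin_add_pi_div_two, Real.cos_int_mul_pi]
      simp
    rw [e2, div_mul_eq_mul_div, ← mul_zpow]
    simp
  refine ((Equiv.subRight (1 : ℤ)).hasSum_iff.2 h2).congr_fun fun j => ?_
  simp only [Function.comp_apply, Equiv.subRight_apply]
  push_cast
  ring_nf

/-- The Riesz interpolation formula at the origin. -/
theorem IsEntireOfExpType.hasSum_riesz {F : ℂ → ℂ} {σ B : ℝ} (hσ : 0 < σ)
    (hF : IsEntireOfExpType F σ) (hB : ∀ x : ℝ, ‖F x‖ ≤ B) :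
    HasSum (fun j : ℤ => ((-1 : ℝ) ^ (j - 1) / ((j : ℝ) - 1 / 2) ^ 2) •
      F (Real.pi / σ * ((j : ℝ) - 1 / 2) : ℝ)) ((Real.pi ^ 2 / σ) • deriv F 0) := by
  have hσ' : (σ : ℂ) ≠ 0 := by exact_mod_cast hσ.ne'
  have hG : ∀ z : ℂ, HasDerivAt (fun w : ℂ => F (Real.pi / σ * w))
      (deriv F (Real.pi / σ * z) * (Real.pi / σ)) z := fun z => by
    have h1 : HasDerivAt (fun w : ℂ => (Real.pi / σ : ℂ) * w) (Real.pi / σ : ℂ) z := by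
      simpa using (hasDerivAt_id z).const_mul (Real.pi / σ : ℂ)
    exact (hF.1 (Real.pi / σ * z)).hasDerivAt.comp z h1
  have h := hasSum_half_integers_deriv (F := fun w : ℂ => F (Real.pi / σ * w)) (B := B)
    (fun z => (hG z).differentiableAt) (fun z => by
      refine (hF.norm_le_mul_exp_abs_im hσ.le hB _).trans (le_of_eq ?_)
      have e : ((Real.pi / σ : ℂ) * z).im = Real.pi / σ * z.im := by
        rw [← Complex.ofReal_div, Complex.im_ofReal_mul]
      rw [e, abs_mul, abs_of_pos (div_pos Real.pi_pos hσ)]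
      congr 2
      field_simp)
  rw [(hG 0).deriv, mul_zero] at h
  have hval : (Real.pi ^ 2 / σ) • deriv F 0 = Real.pi * (deriv F 0 * (Real.pi / σ)) := by
    rw [Complex.real_smul]
    push_cast
    ring
  rw [hval]
  refine ((Equiv.subRight (1 : ℤ)).hasSum_iff.2 h).congr_fun fun j => ?_
  have e : ((j - 1 : ℤ) : ℂ) + 1 / 2 = (j : ℂ) - 1 / 2 := by
    push_cast
    ring
  simp only [Function.comp_apply, Equiv.subRight_apply, e, Complex.real_smul]
  push_cast
  rfl

/-! ### Taylor series of functions with exponentially bounded derivatives -/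

/-- If the `k`-th derivative of a function on the real line is bounded by `C * σ ^ k` for every `k`,
then the function extends to an entire function of exponential type at most `σ`. -/
theorem exists_isEntireOfExpType {v : ℕ → ℝ → ℂ} {C σ : ℝ} (hσ : 0 ≤ σ)
    (hv : ∀ k t, HasDerivAt (v k) (v (k + 1) t) t) (hb : ∀ k t, ‖v k t‖ ≤ C * σ ^ k) :
    ∃ F : ℂ → ℂ, IsEntireOfExpType F σ ∧ ∀ t : ℝ, F t = v 0 t := by
  have hC : 0 ≤ C := by simpa using (norm_nonneg _).trans (hb 0 0)
  have hexp : ∀ r : ℝ, HasSum (fun k : ℕ => C * ((σ * r) ^ k / k.factorial))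
      (C * Real.exp (σ * r)) := fun r => by
    rw [Real.exp_eq_exp_ℝ]
    exact (NormedSpace.expSeries_div_hasSum_exp (σ * r)).mul_left C
  set a : ℕ → ℂ → ℂ := fun k z => z ^ k / k.factorial * v k 0 with ha
  have hle : ∀ k z, ‖a k z‖ ≤ C * ((σ * ‖z‖) ^ k / k.factorial) := by
    intro k z
    rw [ha]
    simp only
    rw [norm_mul, norm_div, norm_pow, Complex.norm_natCast]
    calc ‖z‖ ^ k / k.factorial * ‖v k 0‖ ≤ ‖z‖ ^ k / k.factorial * (C * σ ^ k) := by
          gcongr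
          exact hb k 0
      _ = _ := by rw [mul_pow]; ring
  have hsum : ∀ z, Summable fun k => a k z := fun z =>
    Summable.of_norm_bounded (hexp ‖z‖).summable fun k => hle k z
  refine ⟨fun z => ∑' k, a k z, ⟨fun z => ?_, fun ε hε => ⟨C, fun z => ?_⟩⟩, fun t => ?_⟩
  · have hd : DifferentiableOn ℂ (fun z => ∑' k, a k z) (Metric.ball 0 (‖z‖ + 1)) := by
      refine Complex.differentiableOn_tsum_of_summable_norm (hexp (‖z‖ + 1)).summable
        (fun k => ?_) Metric.isOpen_ball fun k w hw => (hle k w).trans ?_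
      · rw [ha]
        fun_prop
      · rw [mem_ball_zero_iff] at hw
        gcongr
    exact hd.differentiableAt (Metric.isOpen_ball.mem_nhds (by simp))
  · refine (tsum_of_norm_bounded (hexp ‖z‖) fun k => hle k z).trans ?_
    gcongr
    linarith
  · -- The Taylor polynomial of order `n` at `s`, evaluated at `t`, as a function of `s`, has
    -- derivative `(t - s) ^ n / n! * v (n + 1) s`.
    set P : ℕ → ℝ → ℂ := fun n s =>
      ∑ k ∈ Finset.range (n + 1), ((t - s : ℝ) : ℂ) ^ k / k.factorial * v k s with hP
    have hPd : ∀ n s, HasDerivAt (P n)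
        (((t - s : ℝ) : ℂ) ^ n / n.factorial * v (n + 1) s) s := by
      intro n s
      have hlin : HasDerivAt (fun s : ℝ => ((t - s : ℝ) : ℂ)) (-1) s := by
        have := ((hasDerivAt_id s).const_sub t).ofReal_comp
        simpa using this
      induction n with
      | zero => simpa [hP] using hv 0 s
      | succ n ih =>
        have h1 := (((hlin.pow (n + 1)).div_const ((n + 1).factorial : ℂ))).mul (hv (n + 1) s)
        have h2 := ih.add h1
        have e : P (n + 1) = P n + fun s =>
            ((t - s : ℝ) : ℂ) ^ (n + 1) / (n + 1).factorial * v (n + 1) s := by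
          funext s
          simp only [hP, Pi.add_apply]
          rw [Finset.sum_range_succ]
        rw [e]
        refine h2.congr_deriv ?_
        have h3 : (n.factorial : ℂ) ≠ 0 := by exact_mod_cast n.factorial_ne_zero
        have h4 : (n + 1 : ℂ) ≠ 0 := by exact_mod_cast n.succ_ne_zero
        rw [Nat.factorial_succ]
        push_cast
        simp only [Pi.pow_apply]
        field_simp
        ring
    have hrem : ∀ n, ‖P n t - P n 0‖ ≤ C * σ * |t| * ((σ * |t|) ^ n / n.factorial) := by
      intro n
      have h := (convex_uIcc (0 : ℝ) t).norm_image_sub_le_of_norm_hasDerivWithin_le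
        (f := P n) (f' := fun s => ((t - s : ℝ) : ℂ) ^ n / n.factorial * v (n + 1) s)
        (C := |t| ^ n / n.factorial * (C * σ ^ (n + 1)))
        (fun s _ => (hPd n s).hasDerivWithinAt) (fun s hs => ?_)
        Set.left_mem_uIcc Set.right_mem_uIcc
      · refine h.trans (le_of_eq ?_)
        rw [sub_zero, Real.norm_eq_abs, mul_pow]
        ring
      · rw [norm_mul, norm_div, norm_pow, Complex.norm_natCast, Complex.norm_real,
          Real.norm_eq_abs]
        have h1 : |t - s| ≤ |t| := by simpa using Set.abs_sub_right_of_mem_uIcc hs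
        exact mul_le_mul (by gcongr) (hb _ _) (norm_nonneg _) (by positivity)
    have hP0 : Tendsto (fun n => P n 0) atTop (𝓝 (∑' k, a k t)) := by
      have := (hsum t).hasSum.tendsto_sum_nat.comp (tendsto_add_atTop_nat 1)
      simpa [hP, ha, Function.comp_def] using this
    have hPt : ∀ n, P n t = v 0 t := fun n => by
      simp only [hP]
      rw [Finset.sum_range_succ']
      simp
    have hlim : Tendsto (fun n => P n 0) atTop (𝓝 (v 0 t)) := by
      rw [tendsto_iff_norm_sub_tendsto_zero]
      refine squeeze_zero (fun _ => norm_nonneg _) (fun n => ?_)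
        (g := fun n => C * σ * |t| * ((σ * |t|) ^ n / n.factorial)) ?_
      · rw [norm_sub_rev, ← hPt n]
        exact hrem n
      · simpa using (FloorSemiring.tendsto_pow_div_factorial_atTop (σ * |t|)).const_mul
          (C * σ * |t|)
    exact tendsto_nhds_unique hP0 hlim

/-! ### The one-parameter groups and their generators -/

section Translation

variable {d : ℕ} {G : Type*} [TopologicalSpace G] [ChartedSpace (EuclideanSpace ℝ (Fin d)) G]
  [Group G] [LieGroup (𝓡 d) ∞ G] [T2Space G] {M : Type*} [MulAction G M]
  {𝕜 : Type*} [RCLike 𝕜] [MeasurableSpace M] {μ : Measure M} {p : ℝ≥0∞}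
  [MeasurableConstSMul G M] [SMulInvariantMeasure G M μ]

theorem translation_zero (X : GroupLieAlgebra (𝓡 d) G) (f : Lp 𝕜 p μ) :
    translation X 0 f = f := by
  rw [translation, expCurve_zero, DomMulAct.mk_one, one_smul]

theorem translation_add (X : GroupLieAlgebra (𝓡 d) G) (s t : ℝ) (f : Lp 𝕜 p μ) :
    translation X (s + t) f = translation X s (translation X t f) := by
  rw [translation, translation, translation, add_comm, expCurve_add, DomMulAct.mk_mul, mul_smul]

theorem translation_sub (X : GroupLieAlgebra (𝓡 d) G) (t : ℝ) (f g : Lp 𝕜 p μ) :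
    translation X t (f - g) = translation X t f - translation X t g :=
  DomMulAct.smul_Lp_sub _ f g

theorem norm_translation (X : GroupLieAlgebra (𝓡 d) G) (t : ℝ) (f : Lp 𝕜 p μ) :
    ‖translation X t f‖ = ‖f‖ :=
  DomMulAct.norm_smul_Lp _ f

theorem translation_smul (X : GroupLieAlgebra (𝓡 d) G) (t r : ℝ) (f : Lp 𝕜 p μ) :
    translation X t (r • f) = r • translation X t f :=
  smul_comm _ r f

variable [Fact (1 ≤ p)]

theorem continuous_translation (X : GroupLieAlgebra (𝓡 d) G) (t : ℝ) :
    Continuous fun f : Lp 𝕜 p μ => translation X t f :=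
  (isometry_smul (Lp 𝕜 p μ) (DomMulAct.mk (expCurve X t))).continuous

theorem IsGenerator.unique {X : GroupLieAlgebra (𝓡 d) G} {f g h : Lp 𝕜 p μ}
    (hg : IsGenerator X f g) (hh : IsGenerator X f h) : g = h :=
  tendsto_nhds_unique hg hh

theorem IsProduct.unique {X : Fin d → GroupLieAlgebra (𝓡 d) G} {w : List (Fin d)}
    {f g h : Lp 𝕜 p μ} (hg : IsProduct X w f g) (hh : IsProduct X w f h) : g = h := by
  induction w generalizing g h with
  | nil => exact Eq.trans hg (Eq.symm hh)
  | cons i w ih =>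
    obtain ⟨a, ha, hag⟩ := hg
    obtain ⟨b, hb, hbh⟩ := hh
    rw [← ih ha hb] at hbh
    exact hag.unique hbh

theorem IsGenerator.hasDerivAt {X : GroupLieAlgebra (𝓡 d) G} {f g : Lp 𝕜 p μ}
    (h : IsGenerator X f g) (t : ℝ) :
    HasDerivAt (fun s => translation X s f) (translation X t g) t := by
  rw [hasDerivAt_iff_tendsto_slope_zero]
  refine (((continuous_translation X t).tendsto g).comp h).congr fun s => ?_
  rw [Function.comp_apply, translation_smul, translation_sub, translation_add]

/-- The functional `ψ`, followed by the inclusion of the scalars in `ℂ`. -/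
noncomputable def complexFunctional (ψ : StrongDual 𝕜 (Lp 𝕜 p μ)) : Lp 𝕜 p μ →L[ℝ] ℂ :=
  (RCLike.map 𝕜 ℂ).comp (ψ.restrictScalars ℝ)

theorem complexFunctional_apply (ψ : StrongDual 𝕜 (Lp 𝕜 p μ)) (f : Lp 𝕜 p μ) :
    complexFunctional ψ f = RCLike.map 𝕜 ℂ (ψ f) := rfl

theorem RCLike.map_complex_injective : Function.Injective (RCLike.map 𝕜 ℂ) := by
  intro x y h
  apply RCLike.ext
  · simpa using congrArg Complex.re h
  · simpa using congrArg Complex.im h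

theorem eq_of_forall_complexFunctional_eq {f g : Lp 𝕜 p μ}
    (h : ∀ ψ : StrongDual 𝕜 (Lp 𝕜 p μ), complexFunctional ψ f = complexFunctional ψ g) :
    f = g :=
  (SeparatingDual.eq_iff_forall_dual_eq (R := 𝕜)).2 fun ψ => RCLike.map_complex_injective (h ψ)

/-! ### The Riesz interpolation operators -/

theorem norm_rieszTerm (σ : ℝ) (X : GroupLieAlgebra (𝓡 d) G) (f : Lp 𝕜 p μ) (j : ℤ) :
    ‖rieszTerm σ X f j‖ = 1 / ((j : ℝ) - 1 / 2) ^ 2 * ‖f‖ := by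
  rw [rieszTerm, norm_smul, norm_translation, norm_div, norm_zpow, norm_neg, norm_one, one_zpow,
    norm_pow, Real.norm_eq_abs, sq_abs]

theorem summable_rieszTerm (σ : ℝ) (X : GroupLieAlgebra (𝓡 d) G) (f : Lp 𝕜 p μ) :
    Summable (rieszTerm σ X f) :=
  Summable.of_norm ((hasSum_one_div_sub_half_sq.summable.mul_right ‖f‖).congr fun j =>
    (norm_rieszTerm σ X f j).symm)

theorem norm_rieszOperator_le {σ : ℝ} (hσ : 0 ≤ σ) (X : GroupLieAlgebra (𝓡 d) G)
    (f : Lp 𝕜 p μ) : ‖rieszOperator σ X f‖ ≤ σ * ‖f‖ := by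
  have h : ‖∑' j : ℤ, rieszTerm σ X f j‖ ≤ Real.pi ^ 2 * ‖f‖ :=
    tsum_of_norm_bounded (hasSum_one_div_sub_half_sq.mul_right ‖f‖) fun j =>
      (norm_rieszTerm σ X f j).le
  rw [rieszOperator, norm_smul, Real.norm_of_nonneg (by positivity)]
  calc σ / Real.pi ^ 2 * ‖∑' j : ℤ, rieszTerm σ X f j‖
      ≤ σ / Real.pi ^ 2 * (Real.pi ^ 2 * ‖f‖) := by gcongr
    _ = σ * ‖f‖ := by
      have := Real.pi_ne_zero
      field_simp

theorem norm_rieszProduct_le {σ : ℝ} (hσ : 0 ≤ σ) (X : Fin d → GroupLieAlgebra (𝓡 d) G)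
    (w : List (Fin d)) (f : Lp 𝕜 p μ) : ‖rieszProduct σ X w f‖ ≤ σ ^ w.length * ‖f‖ := by
  induction w with
  | nil => simp [rieszProduct]
  | cons i w ih =>
    rw [rieszProduct, List.length_cons, pow_succ', mul_assoc]
    exact (norm_rieszOperator_le hσ _ _).trans (mul_le_mul_of_nonneg_left ih hσ)

/-- The Riesz interpolation formula for a vector whose orbit is, weakly, bounded and of exponential
type at most `σ`. -/
theorem IsGenerator.eq_rieszOperator {σ : ℝ} (hσ : 0 < σ) {X : GroupLieAlgebra (𝓡 d) G}
    {f g : Lp 𝕜 p μ} (h : IsGenerator X f g)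
    (hψ : ∀ ψ : StrongDual 𝕜 (Lp 𝕜 p μ),
      ExtendsBoundedExpType (fun t : ℝ => ψ (translation X t f)) σ) :
    g = rieszOperator σ X f := by
  refine eq_of_forall_complexFunctional_eq fun ψ => ?_
  obtain ⟨⟨F, hF, hFψ⟩, -⟩ := hψ ψ
  have hFt : ∀ t : ℝ, F t = complexFunctional ψ (translation X t f) := hFψ
  have hbound : ∀ t : ℝ, ‖F t‖ ≤ ‖complexFunctional ψ‖ * ‖f‖ := fun t => by
    rw [hFt, ← norm_translation X t f]
    exact (complexFunctional ψ).le_opNorm _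
  have hderiv : deriv F 0 = complexFunctional ψ g := by
    have h1 : HasDerivAt (fun t : ℝ => F t) (deriv F ((0 : ℝ) : ℂ)) 0 :=
      (hF.1 ((0 : ℝ) : ℂ)).hasDerivAt.comp_ofReal
    have h2 := (complexFunctional ψ).hasFDerivAt.comp_hasDerivAt (0 : ℝ) (h.hasDerivAt 0)
    rw [translation_zero] at h2
    rw [← Complex.ofReal_zero]
    exact h1.unique (h2.congr_of_eventuallyEq (Eventually.of_forall hFt))
  have hsum := hF.hasSum_riesz hσ hbound
  have hsum2 := (complexFunctional ψ).hasSum (summable_rieszTerm σ X f).hasSum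
  have hval : complexFunctional ψ (∑' j, rieszTerm σ X f j)
      = (Real.pi ^ 2 / σ) • complexFunctional ψ g := by
    rw [← hderiv]
    refine (hsum2.congr_fun fun j => ?_).unique hsum
    rw [rieszTerm, map_smul, hFt]
  have hpi := Real.pi_ne_zero
  rw [rieszOperator, map_smul, hval, smul_smul]
  have e : σ / Real.pi ^ 2 * (Real.pi ^ 2 / σ) = 1 := by field_simp
  rw [e, one_smul]

/-! ### Orbits of vectors of the Bernstein space -/

theorem extendsBoundedExpType_of_mem_bernsteinSpace {σ : ℝ} (hσ : 0 ≤ σ)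
    {X : Fin d → GroupLieAlgebra (𝓡 d) G} {f g : Lp 𝕜 p μ} (hf : f ∈ bernsteinSpace X σ)
    {w : List (Fin d)} (hg : IsProduct X w f g) (j : Fin d) (ψ : StrongDual 𝕜 (Lp 𝕜 p μ)) :
    ExtendsBoundedExpType (fun t : ℝ => ψ (translation (X j) t g)) σ := by
  -- `D k` is the `k`-th power of the generator of index `j` applied to `g`.
  choose D hD hDle using fun k : ℕ => hf (List.replicate k j ++ w)
  have hD0 : D 0 = g := (hD 0).unique hg
  have hgen : ∀ k, IsGenerator (X j) (D k) (D (k + 1)) := by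
    intro k
    obtain ⟨h, hh, hgen⟩ := hD (k + 1)
    rwa [(hD k).unique hh]
  refine ⟨?_, ‖ψ‖ * ‖g‖, fun t => ?_⟩
  · have hderiv : ∀ k t, HasDerivAt (fun t => complexFunctional ψ (translation (X j) t (D k)))
        (complexFunctional ψ (translation (X j) t (D (k + 1)))) t := fun k t =>
      (complexFunctional ψ).hasFDerivAt.comp_hasDerivAt t ((hgen k).hasDerivAt t)
    obtain ⟨F, hF, hFt⟩ := exists_isEntireOfExpType (σ := σ)
      (C := ‖complexFunctional ψ‖ * (σ ^ w.length * ‖f‖)) hσ hderiv (fun k t => by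
        refine ((complexFunctional ψ).le_opNorm _).trans ?_
        rw [norm_translation, mul_assoc]
        refine mul_le_mul_of_nonneg_left ((hDle k).trans (le_of_eq ?_)) (norm_nonneg _)
        rw [List.length_append, List.length_replicate, pow_add]
        ring)
    refine ⟨F, hF, fun t => ?_⟩
    rw [hFt, hD0, complexFunctional_apply]
  · rw [← norm_translation (X j) t g]
    exact ψ.le_opNorm _

/-- If all orbits `t ↦ e^{tD_j} D_{i₁} ... D_{i_k} f` are, weakly, bounded and of exponential type
at most `σ`, then every product of generators acts on `f` as the product of Riesz operators. -/
theorem isProduct_rieszProduct {σ : ℝ} (hσ : 0 < σ) {X : Fin d → GroupLieAlgebra (𝓡 d) G}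
    {f : Lp 𝕜 p μ}
    (hf : ∀ w : List (Fin d), ∃ g : Lp 𝕜 p μ, IsProduct X w f g ∧
      ∀ (j : Fin d) (ψ : StrongDual 𝕜 (Lp 𝕜 p μ)),
        ExtendsBoundedExpType (fun t : ℝ => ψ (translation (X j) t g)) σ)
    (w : List (Fin d)) : IsProduct X w f (rieszProduct σ X w f) := by
  induction w with
  | nil => rfl
  | cons i w ih =>
    obtain ⟨a, ha, haψ⟩ := hf w
    obtain ⟨g, ⟨b, hb, hgen⟩, -⟩ := hf (i :: w)
    obtain rfl := ha.unique ih
    obtain rfl := hb.unique ha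
    rw [rieszProduct, ← hgen.eq_rieszOperator hσ (haψ i)]
    exact ⟨_, hb, hgen⟩

end Translation

/-! ### Equivalence of the three descriptions of the Bernstein space -/

theorem theorem1p1
    -- the compact Lie group `G`, of dimension `d`
    {d : ℕ} {G : Type*} [TopologicalSpace G] [ChartedSpace (EuclideanSpace ℝ (Fin d)) G] [Group G]
    [LieGroup (𝓡 d) ∞ G] [T2Space G] [CompactSpace G]
    -- the compact connected smooth manifold `M`
    {m : ℕ} {M : Type*} [TopologicalSpace M] [ChartedSpace (EuclideanSpace ℝ (Fin m)) M]
    [IsManifold (𝓡 m) ∞ M] [T2Space M] [CompactSpace M] [ConnectedSpace M]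
    -- the smooth, effective and transitive action of `G` on `M`
    [MulAction G M] [ContinuousSMul G M] [ContMDiffSMul (𝓡 d) (𝓡 m) ∞ G M] [FaithfulSMul G M]
    [MulAction.IsPretransitive G M]
    -- the invariant measure on `M`
    [MeasurableSpace M] [BorelSpace M] (μ : Measure M) [IsFiniteMeasure μ]
    [SMulInvariantMeasure G M μ]
    -- the vector fields `X₁, ..., X_d`, whose sum of squares commutes with each of them
    (X : Fin d → GroupLieAlgebra (𝓡 d) G)
    (hX : ∀ φ : M → ℝ, ContMDiff (𝓡 m) 𝓘(ℝ, ℝ) ∞ φ → ∀ j,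
      sumOfSquares X (vectorFieldAction (X j) φ) = vectorFieldAction (X j) (sumOfSquares X φ))
    -- the scalars, `ℝ` or `ℂ`, the exponent, and the exponential type `σ`
    {𝕜 : Type*} [RCLike 𝕜] (p : ℝ≥0∞) [Fact (1 ≤ p)] (σ : ℝ) (hσ : 0 < σ) :
    -- the series in the Riesz interpolation formula converge in `L_p(M)`
    (∀ (i : Fin d) (g : Lp 𝕜 p μ), Summable (rieszTerm σ (X i) g)) ∧
    ∀ f : Lp 𝕜 p μ, List.TFAE [
      f ∈ bernsteinSpace X σ,
      ∀ w : List (Fin d), ∃ g : Lp 𝕜 p μ, IsProduct X w f g ∧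
        ∀ (j : Fin d) (ψ : StrongDual 𝕜 (Lp 𝕜 p μ)),
          ExtendsBoundedExpType (fun t : ℝ => ψ (translation (X j) t g)) σ,
      ∀ w : List (Fin d), IsProduct X w f (rieszProduct σ X w f)] := by
  refine ⟨fun i g => summable_rieszTerm σ (X i) g, fun f => ?_⟩
  tfae_have 1 → 2 := fun hf w => by
    obtain ⟨g, hg, -⟩ := hf w
    exact ⟨g, hg, fun j ψ => extendsBoundedExpType_of_mem_bernsteinSpace hσ.le hf hg j ψ⟩
  tfae_have 2 → 3 := isProduct_rieszProduct hσ
  tfae_have 3 → 1 := fun hf w => ⟨_, hf w, norm_rieszProduct_le hσ.le X w f⟩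
  tfae_finish
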